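/- Let $M$ be a smooth real manifold of dimension three with a smooth complex-valued metric $g_{ab}$, that is, a smooth symmetric section of $T^*M\otimes T^*M\otimes\mathbb{C}$ whose complex-bilinear extension to $T^{\mathbb{C}}M=\mathbb{C}\otimes TM$ is non-degenerate (for example a real pseudo-Riemannian metric of any signature). Let $\nabla_a$ be its Levi-Civita connection, extended complex-linearly. Use the conventions $R_{abd}{}^{c}V^d=2\nabla_{[a}\nabla_{b]}V^c$, $R_{ab}=R_{acb}{}^{c}$, $R=g^{ab}R_{ab}$, and put $$\Phi_{ab}=R_{ab}-\tfrac13 R\,g_{ab},\qquad S=\tfrac1{12}R,\qquad \mathrm{P}_{ab}=-\Phi_{ab}-S\,g_{ab},\qquad A_{abc}=2\nabla_{[b}\mathrm{P}_{c]a},$$ so that $\Phi_{ab}$ is the tracefree Ricci tensor and $A_{abc}$ is the Cotton tensor. A *null structure* is a smooth complex line subbundle $\mathcal{N}\subset T^{\mathbb{C}}M$ with $g_{ab}k^ak^b=0$ for every $k^a\in\mathcal{N}$; $\mathcal{N}^\perp$ is its orthogonal complement. It is *co-geodetic* if $g(\nabla_XY,Z)=0$ for all (local) smooth sections $X,Y$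 of $\mathcal{N}^\perp$ and $Z$ of $\mathcal{N}$. At a point $p$, in a frame $(k^a,\ell^a,n^a)$ of $T^{\mathbb{C}}_pM$ with $g_{ab}=2k_{(a}\ell_{b)}-2n_an_b$, the null directions are spanned by the vectors $\xi^a=s^2k^a+2st\,n^a+t^2\ell^a$, $[s:t]\in\mathbb{CP}^1$, and one considers the quartic form $$\tfrac12\Phi_{ab}\xi^a\xi^b=\Phi_0s^4+4\Phi_1s^3t+6\Phi_2s^2t^2+4\Phi_3st^3+\Phi_4t^4 .$$ The null structure $\mathcal{N}$ is *multiple principal* at $p$ if the point $[s:t]$ that represents $\mathcal{N}_p$ is a multiple root of this form. The tensor $\Phi_{ab}$ is *of Petrov type III* at $p$, and does not degenerate further, if the roots of this form have multiplicities exactly $\{3,1\}$, i.e. the form is $\alpha^3\beta$ for two non-proportional linear forms $\alpha,\beta$ in $(s,t)$. (If $\mathcal{N}$ is multiple principal and the frame is adapted to it, so that $k^a$ spans $\mathcal{N}_p$, this says $\Phi_0=\Phi_1=\Phi_2=0$ and $\Phi_3\neq0$.) **Theorem.** Let $\mathcal{N}$ be a null structure on $(M,g)$ that is multiple principal at every point,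 and assume that at every point $\Phi_{ab}$ is of Petrov type III and does not degenerate further. Suppose that, for any generator $k^a$ of $\mathcal{N}$, $$k^a\left(A_{abc}-2\,g_{a[b}\nabla_{c]}S\right)=0,\qquad k^ak^bA_{abc}=0,\qquad k^a\nabla_aS=0 .$$ Then $\mathcal{N}$ is co-geodetic. -/

import Mathlib

open scoped Manifold ContDiff TensorProduct Matrix

namespace ThreeGeometry

noncomputable section

/-- The model space of a three-dimensional smooth manifold. -/
abbrev E3 : Type := EuclideanSpace ℝ (Fin 3)

/-! ### Tensor calculus of a complex-valued metric in a coordinate domain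

`G x` is the matrix `(g_{ij}(x))` of the metric at the point with coordinates `x`. -/

/-- The partial derivative `∂_i f`. -/
def pd (i : Fin 3) (f : E3 → ℂ) (x : E3) : ℂ :=
  fderiv ℝ f x (EuclideanSpace.single i (1 : ℝ))

/-- The Christoffel symbol `Γ^c_{ab}` of the Levi-Civita connection. -/
def christoffel (G : E3 → Matrix (Fin 3) (Fin 3) ℂ) (c a b : Fin 3) (x : E3) : ℂ :=
  (1 / 2) * ∑ d, (G x)⁻¹ c d *
    (pd a (fun y => G y d b) x + pd b (fun y => G y d a) x - pd d (fun y => G y a b) x)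

/-- `∇_a V^c = ∂_a V^c + Γ^c_{ab} V^b`. -/
def covDerivVec (G : E3 → Matrix (Fin 3) (Fin 3) ℂ) (V : E3 → Fin 3 → ℂ)
    (a c : Fin 3) (x : E3) : ℂ :=
  pd a (fun y => V y c) x + ∑ b, christoffel G c a b x * V x b

/-- `∇_c T_{ab} = ∂_c T_{ab} - Γ^d_{ca} T_{db} - Γ^d_{cb} T_{ad}`. -/
def covDerivTensor (G : E3 → Matrix (Fin 3) (Fin 3) ℂ) (T : Fin 3 → Fin 3 → E3 → ℂ)
    (c a b : Fin 3) (x : E3) : ℂ :=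
  pd c (T a b) x - ∑ d, christoffel G d c a x * T d b x - ∑ d, christoffel G d c b x * T a d x

/-- The component `R_{abd}{}^c` of the Riemann tensor, with the convention
`R_{abd}{}^c V^d = ∇_a ∇_b V^c - ∇_b ∇_a V^c`. -/
def riemann (G : E3 → Matrix (Fin 3) (Fin 3) ℂ) (a b d c : Fin 3) (x : E3) : ℂ :=
  pd a (christoffel G c b d) x - pd b (christoffel G c a d) x
    + ∑ f, (christoffel G c a f x * christoffel G f b d x
      - christoffel G c b f x * christoffel G f a d x)

/-- The Ricci tensor `R_{ab} = R_{acb}{}^c`. -/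
def ricci (G : E3 → Matrix (Fin 3) (Fin 3) ℂ) (a b : Fin 3) (x : E3) : ℂ :=
  ∑ c, riemann G a c b c x

/-- The Ricci scalar `R = g^{ab} R_{ab}`. -/
def ricciScalar (G : E3 → Matrix (Fin 3) (Fin 3) ℂ) (x : E3) : ℂ :=
  ∑ a, ∑ b, (G x)⁻¹ a b * ricci G a b x

/-- The tracefree Ricci tensor `Φ_{ab} = R_{ab} - (1/3) R g_{ab}`. -/
def phi (G : E3 → Matrix (Fin 3) (Fin 3) ℂ) (a b : Fin 3) (x : E3) : ℂ :=
  ricci G a b x - (1 / 3) * ricciScalar G x * G x a b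

/-- `S = R / 12`. -/
def scalarS (G : E3 → Matrix (Fin 3) (Fin 3) ℂ) (x : E3) : ℂ :=
  (1 / 12) * ricciScalar G x

/-- The Schouten tensor `P_{ab} = -Φ_{ab} - S g_{ab}`. -/
def schouten (G : E3 → Matrix (Fin 3) (Fin 3) ℂ) (a b : Fin 3) (x : E3) : ℂ :=
  - phi G a b x - scalarS G x * G x a b

/-- The Cotton tensor `A_{abc} = 2 ∇_{[b} P_{c]a} = ∇_b P_{ca} - ∇_c P_{ba}`. -/
def cotton (G : E3 → Matrix (Fin 3) (Fin 3) ℂ) (a b c : Fin 3) (x : E3) : ℂ :=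
  covDerivTensor G (schouten G) b c a x - covDerivTensor G (schouten G) c b a x

/-! ### The complexified tangent bundle and complex-valued metrics -/

variable {M : Type*} [TopologicalSpace M] [ChartedSpace E3 M] [IsManifold 𝓘(ℝ, E3) ∞ M]

/-- The fibre `ℂ ⊗ T_p M` of the complexified tangent bundle. -/
abbrev CTangent (p : M) : Type := ℂ ⊗[ℝ] TangentSpace 𝓘(ℝ, E3) p

/-- The complex-bilinear extension to `ℂ ⊗ T_p M` of a complex-valued real-bilinear form. -/
def complexify {p : M}
    (B : TangentSpace 𝓘(ℝ, E3) p →L[ℝ] TangentSpace 𝓘(ℝ, E3) p →L[ℝ] ℂ) :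
    CTangent p →ₗ[ℂ] CTangent p →ₗ[ℂ] ℂ :=
  LinearMap.liftBaseChange ℂ
    { toFun := fun v => LinearMap.liftBaseChange ℂ (B v).toLinearMap
      map_add' := fun v w => by ext u; simp
      map_smul' := fun r v => by ext u; simp }

variable (M) in
/-- A smooth complex-valued metric on `M`: a smooth symmetric section of
`T*M ⊗ T*M ⊗ ℂ` whose complex-bilinear extension to `ℂ ⊗ TM` is non-degenerate.
The pseudo-Riemannian metrics are the ones with real values. -/
structure ComplexMetric where
  form : ∀ p : M, TangentSpace 𝓘(ℝ, E3) p →L[ℝ] TangentSpace 𝓘(ℝ, E3) p →L[ℝ] ℂ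
  symm : ∀ p v w, form p v w = form p w v
  nondegenerate : ∀ (p : M) (V : CTangent p), (∀ W, complexify (form p) V W = 0) → V = 0
  smooth : ContMDiff 𝓘(ℝ, E3) (𝓘(ℝ, E3).prod 𝓘(ℝ, E3 →L[ℝ] E3 →L[ℝ] ℂ)) ∞
    (fun p => Bundle.TotalSpace.mk' (E3 →L[ℝ] E3 →L[ℝ] ℂ)
      (E := fun q : M => TangentSpace 𝓘(ℝ, E3) q →L[ℝ] TangentSpace 𝓘(ℝ, E3) q →L[ℝ] ℂ)
      p (form p))

/-- A complex vector field is smooth on `U` if its real and imaginary parts are. -/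
def SmoothFieldOn (V : ∀ p : M, CTangent p) (U : Set M) : Prop :=
  ∃ X Y : ∀ p : M, TangentSpace 𝓘(ℝ, E3) p,
    ContMDiffOn 𝓘(ℝ, E3) 𝓘(ℝ, E3).tangent ∞
      (fun p => (⟨p, X p⟩ : TangentBundle 𝓘(ℝ, E3) M)) U ∧
    ContMDiffOn 𝓘(ℝ, E3) 𝓘(ℝ, E3).tangent ∞
      (fun p => (⟨p, Y p⟩ : TangentBundle 𝓘(ℝ, E3) M)) U ∧
    ∀ p ∈ U, V p = (1 : ℂ) ⊗ₜ[ℝ] X p + Complex.I ⊗ₜ[ℝ] Y p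

/-- The components `V^i = dx^i(V)` of `V ∈ ℂ ⊗ T_p M` in the coordinates of the chart `e`. -/
def comp (e : OpenPartialHomeomorph M E3) {p : M} (V : CTangent p) (i : Fin 3) : ℂ :=
  LinearMap.liftBaseChange ℂ
    (Complex.ofRealCLM ∘L (EuclideanSpace.proj i : E3 →L[ℝ] ℝ) ∘L
      (mfderiv 𝓘(ℝ, E3) 𝓘(ℝ, E3) e p : TangentSpace 𝓘(ℝ, E3) p →L[ℝ] E3)).toLinearMap V

namespace ComplexMetric

variable (g : ComplexMetric M)

/-- The metric on the complexified tangent space. -/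
def inner {p : M} (V W : CTangent p) : ℂ := complexify (g.form p) V W

/-- The components `g_{ij} = g(∂_i, ∂_j)` in the coordinates of the chart `e`, as functions of the
coordinates. -/
def matrix (e : OpenPartialHomeomorph M E3) (x : E3) : Matrix (Fin 3) (Fin 3) ℂ :=
  Matrix.of fun i j => g.form (e.symm x)
    (mfderiv 𝓘(ℝ, E3) 𝓘(ℝ, E3) e.symm x (EuclideanSpace.single i (1 : ℝ)))
    (mfderiv 𝓘(ℝ, E3) 𝓘(ℝ, E3) e.symm x (EuclideanSpace.single j (1 : ℝ)))

/-- `Φ_{ab} V^a W^b` at `p`, computed in the chart `e`. -/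
def phiAt (e : OpenPartialHomeomorph M E3) {p : M} (V W : CTangent p) : ℂ :=
  ∑ a, ∑ b, phi (g.matrix e) a b (e p) * comp e V a * comp e W b

/-- `A_{abc} U^a V^b W^c` at `p`, computed in the chart `e`. -/
def cottonAt (e : OpenPartialHomeomorph M E3) {p : M} (U V W : CTangent p) : ℂ :=
  ∑ a, ∑ b, ∑ c, cotton (g.matrix e) a b c (e p) * comp e U a * comp e V b * comp e W c

/-- `V^a ∇_a S` at `p`, computed in the chart `e`. -/
def dS (e : OpenPartialHomeomorph M E3) {p : M} (V : CTangent p) : ℂ :=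
  ∑ a, comp e V a * pd a (scalarS (g.matrix e)) (e p)

/-- `g(∇_X Y, Z)` at `p`, computed in the chart `e`, where `∇` is the Levi-Civita connection
extended complex-linearly. -/
def innerCovDeriv (e : OpenPartialHomeomorph M E3) (X Y Z : ∀ p : M, CTangent p) (p : M) : ℂ :=
  ∑ a, ∑ c, ∑ d, g.matrix e (e p) c d * comp e (X p) a *
    covDerivVec (g.matrix e) (fun x => comp e (Y (e.symm x))) a c (e p) * comp e (Z p) d

/-- A null frame `(k, ℓ, n)` of `ℂ ⊗ T_p M`, i.e. `g_{ab} = 2 k_{(a} ℓ_{b)} - 2 n_a n_b`. -/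
structure NullFrame (p : M) where
  k : CTangent p
  l : CTangent p
  n : CTangent p
  kk : g.inner k k = 0
  ll : g.inner l l = 0
  kl : g.inner k l = 1
  kn : g.inner k n = 0
  ln : g.inner l n = 0
  nn : g.inner n n = -(1 / 2)

/-- The null vector `ξ = s² k + 2 s t n + t² ℓ` with homogeneous coordinates `[s : t]`. In the
affine coordinate `z = t / s` it is `k + 2 z n + z² ℓ` up to scale. -/
def NullFrame.xi {g : ComplexMetric M} {p : M} (F : g.NullFrame p) (s t : ℂ) : CTangent p :=
  s ^ 2 • F.k + (2 * s * t) • F.n + t ^ 2 • F.l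

/-- The quartic form `(1/2) Φ_{ab} ξ^a ξ^b
= Φ₀ s⁴ + 4 Φ₁ s³ t + 6 Φ₂ s² t² + 4 Φ₃ s t³ + Φ₄ t⁴` in the coordinates `[s : t]`
on the projective line of null directions. -/
def NullFrame.quartic {g : ComplexMetric M} {p : M} (F : g.NullFrame p)
    (e : OpenPartialHomeomorph M E3) (s t : ℂ) : ℂ :=
  (1 / 2) * g.phiAt e (F.xi s t) (F.xi s t)

/-- `Φ` is of Petrov type III at `p`: the root multiplicities of the quartic are
`{3, 1}`, i.e. it is `α³ β` with linear forms `α` and `β` that are not proportional. -/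
def IsPetrovIIIAt (e : OpenPartialHomeomorph M E3) (p : M) : Prop :=
  ∃ (F : g.NullFrame p) (α β : Fin 2 → ℂ), α 0 * β 1 - α 1 * β 0 ≠ 0 ∧
    ∀ s t : ℂ, F.quartic e s t = (α 0 * s + α 1 * t) ^ 3 * (β 0 * s + β 1 * t)

/-- The tracefree Ricci tensor is of Petrov type III, and of no more degenerate type, at every
point. -/
def IsPetrovIII : Prop :=
  ∀ e ∈ atlas E3 M, ∀ p ∈ e.source, g.IsPetrovIIIAt e p

end ComplexMetric

/-- A null structure: a smooth complex line subbundle `N` of `ℂ ⊗ TM` that is null. -/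
structure NullStructure (g : ComplexMetric M) where
  line : ∀ p : M, Submodule ℂ (CTangent p)
  finrank_line : ∀ p, Module.finrank ℂ (line p) = 1
  null : ∀ p, ∀ k ∈ line p, g.inner k k = 0
  smooth : ∀ p : M, ∃ U : Set M, IsOpen U ∧ p ∈ U ∧ ∃ k : ∀ q : M, CTangent q,
    SmoothFieldOn k U ∧ ∀ q ∈ U, line q = Submodule.span ℂ {k q}

namespace NullStructure

variable {g : ComplexMetric M} (N : NullStructure g)

/-- The fibre at `p` of the orthogonal complement of `N`, as a predicate. -/
def InPerp {p : M} (V : CTangent p) : Prop := ∀ k ∈ N.line p, g.inner V k = 0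

/-- `N` is a multiple principal null structure at every point: in a frame adapted to
`N`, so that `N` has the coordinate `[1 : 0]` (that is, `z = 0`), the quartic is divisible
by `t²`. -/
def IsMultiplePrincipal : Prop :=
  ∀ e ∈ atlas E3 M, ∀ p ∈ e.source, ∃ F : g.NullFrame p, F.k ∈ N.line p ∧
    ∃ c₀ c₁ c₂ : ℂ, ∀ s t : ℂ,
      F.quartic e s t = t ^ 2 * (c₀ * s ^ 2 + c₁ * s * t + c₂ * t ^ 2)

/-- `N` is co-geodetic: `g(∇_X Y, Z) = 0` for all sections `X, Y` of the orthogonal complement of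
`N` and all sections `Z` of `N`, over any open set. -/
def IsCoGeodetic : Prop :=
  ∀ U : Set M, IsOpen U → ∀ X Y Z : ∀ p : M, CTangent p,
    SmoothFieldOn X U → SmoothFieldOn Y U → SmoothFieldOn Z U →
    (∀ p ∈ U, N.InPerp (X p)) → (∀ p ∈ U, N.InPerp (Y p)) → (∀ p ∈ U, Z p ∈ N.line p) →
    ∀ e ∈ atlas E3 M, ∀ p ∈ U ∩ e.source, g.innerCovDeriv e X Y Z p = 0

end NullStructure

end

end ThreeGeometry

/-! Let `k` be a smooth local generator of the null line. In a null frame adapted to it, type III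
with `k` a multiple root means `Φ(k, ·) = 0`, `Φ(n, n) = 0` and `Φ(ℓ, n) ≠ 0`
(`adapted_components`). Since this holds at every point, `Φ_{ca} k^a = 0` may be differentiated:
`(∇_b Φ_{ca}) k^a = - Φ_{ca} ∇_b k^a`. Skew-symmetrizing gives `k^a A_{abc} U^b V^c = Φ(V, ∇_U k) -
Φ(U, ∇_V k)` plus terms in `dS` (`sum_cotton`). These are exactly the terms subtracted in the
curvature hypothesis, so `Φ(V, ∇_U k)` is symmetric in `U` and `V`.

The rest is linear algebra (`bil_eq_zero_of_symm`). As `k` is null, every `∇_U k` is orthogonal to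
`k`, hence lies in the span of `k` and `n`. Take `V = ℓ` and `U = X` orthogonal to `k`. Then `Φ(X,
∇_ℓ k) = 0`, because `Φ` vanishes on that span, while `Φ(ℓ, ∇_X k)` is `Φ(ℓ, n)` times the
`n`-coefficient of `∇_X k`. That coefficient is therefore zero, and `g(∇_X Y, k) = - g(Y, ∇_X k) =
0`.

Everything is computed in a chart. The metric identities are derived from the Christoffel symbols,
and the frames are only needed pointwise, since the only fields differentiated are `k` and `Y`. -/

namespace ThreeGeometry

noncomputable section

/-! ### Rules for partial derivatives -/

section PartialDerivative

variable {f h : E3 → ℂ} {x : E3} (i j : Fin 3)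

lemma pd_sub (hf : DifferentiableAt ℝ f x) (hh : DifferentiableAt ℝ h x) :
    pd i (fun y => f y - h y) x = pd i f x - pd i h x := by
  simp [pd, fderiv_fun_sub hf hh]

lemma pd_neg : pd i (fun y => - f y) x = - pd i f x := by
  simp [pd, fderiv_fun_neg]

lemma pd_mul (hf : DifferentiableAt ℝ f x) (hh : DifferentiableAt ℝ h x) :
    pd i (fun y => f y * h y) x = pd i f x * h x + f x * pd i h x := by
  simp [pd, fderiv_fun_mul hf hh]
  ring

lemma pd_const (c : ℂ) : pd i (fun _ => c) x = 0 := by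
  simp [pd]

lemma pd_const_mul (c : ℂ) (hf : DifferentiableAt ℝ f x) :
    pd i (fun y => c * f y) x = c * pd i f x := by
  rw [pd_mul i (differentiableAt_const c) hf, pd_const]
  ring

lemma pd_sum {ι : Type*} (s : Finset ι) {F : ι → E3 → ℂ}
    (hF : ∀ a ∈ s, DifferentiableAt ℝ (F a) x) :
    pd i (fun y => ∑ a ∈ s, F a y) x = ∑ a ∈ s, pd i (F a) x := by
  simp [pd, fderiv_fun_sum hF]

lemma pd_congr (hfh : f =ᶠ[nhds x] h) : pd i f x = pd i h x := by
  simp [pd, hfh.fderiv_eq]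

lemma contDiffAt_pd (hf : ContDiffAt ℝ ∞ f x) : ContDiffAt ℝ ∞ (pd i f) x :=
  (hf.fderiv_right (m := ∞) (by simp)).clm_apply contDiffAt_const

lemma pd_comm (hf : ContDiffAt ℝ ∞ f x) : pd i (pd j f) x = pd j (pd i f) x := by
  have hd : DifferentiableAt ℝ (fderiv ℝ f) x :=
    (hf.fderiv_right (m := ∞) (by simp)).differentiableAt (by simp)
  have key (a b : Fin 3) : pd a (pd b f) x =
      fderiv ℝ (fderiv ℝ f) x (EuclideanSpace.single a (1 : ℝ))
        (EuclideanSpace.single b (1 : ℝ)) := by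
    unfold pd
    rw [fderiv_clm_apply hd (differentiableAt_const _)]
    simp
  rw [key, key]
  exact (hf.isSymmSndFDerivAt (by simpa using ENat.LEInfty.out)).eq _ _

end PartialDerivative

/-! ### Metrics in coordinates -/

/-- `G` is a symmetric matrix function which is smooth and non-degenerate at `x`. -/
structure IsMetricAt (G : E3 → Matrix (Fin 3) (Fin 3) ℂ) (x : E3) : Prop where
  symm : ∀ y i j, G y i j = G y j i
  smooth : ∀ i j, ContDiffAt ℝ ∞ (fun y => G y i j) x
  det_ne : (G x).det ≠ 0

namespace IsMetricAt

variable {G : E3 → Matrix (Fin 3) (Fin 3) ℂ} {x : E3} (hG : IsMetricAt G x)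

include hG

lemma contDiffAt_det : ContDiffAt ℝ ∞ (fun y => (G y).det) x := by
  have := hG.smooth
  simp only [Matrix.det_fin_three]
  fun_prop

lemma eventually_det_ne : ∀ᶠ y in nhds x, (G y).det ≠ 0 :=
  hG.contDiffAt_det.continuousAt.eventually_ne hG.det_ne

lemma contDiffAt_inv (i j : Fin 3) : ContDiffAt ℝ ∞ (fun y => (G y)⁻¹ i j) x := by
  have h := hG.smooth
  have hadj : ContDiffAt ℝ ∞ (fun y => (G y).adjugate i j) x := by
    fin_cases i <;> fin_cases j <;> simp [Matrix.adjugate_fin_three] <;> fun_prop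
  simp only [Matrix.inv_def, Matrix.smul_apply, Ring.inverse_eq_inv', smul_eq_mul]
  exact (hG.contDiffAt_det.inv hG.det_ne).mul hadj

lemma differentiableAt (i j : Fin 3) : DifferentiableAt ℝ (fun y => G y i j) x :=
  (hG.smooth i j).differentiableAt (by simp)

lemma differentiableAt_inv (i j : Fin 3) : DifferentiableAt ℝ (fun y => (G y)⁻¹ i j) x :=
  (hG.contDiffAt_inv i j).differentiableAt (by simp)

lemma inv_mul : (G x)⁻¹ * G x = 1 := Matrix.nonsing_inv_mul _ (Ne.isUnit hG.det_ne)

lemma mul_inv : G x * (G x)⁻¹ = 1 := Matrix.mul_nonsing_inv _ (Ne.isUnit hG.det_ne)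

lemma inv_symm (y : E3) (i j : Fin 3) : (G y)⁻¹ i j = (G y)⁻¹ j i := by
  have : (G y)ᵀ = G y := by ext a b; exact hG.symm y b a
  rw [← Matrix.transpose_apply (G y)⁻¹, Matrix.transpose_nonsing_inv, this]

/-! ### Smoothness of the connection and of the curvature components. -/

lemma contDiffAt_christoffel (c a b : Fin 3) : ContDiffAt ℝ ∞ (christoffel G c a b) x := by
  have h (i j k : Fin 3) := contDiffAt_pd i (hG.smooth j k)
  exact contDiffAt_const.mul (ContDiffAt.sum fun d _ =>
    (hG.contDiffAt_inv c d).mul (((h a d b).add (h b d a)).sub (h d a b)))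

lemma contDiffAt_riemann (a b d c : Fin 3) : ContDiffAt ℝ ∞ (riemann G a b d c) x := by
  unfold riemann
  have h1 := hG.contDiffAt_christoffel
  have h2 (i j k l : Fin 3) := contDiffAt_pd i (hG.contDiffAt_christoffel j k l)
  fun_prop

lemma contDiffAt_ricci (a b : Fin 3) : ContDiffAt ℝ ∞ (ricci G a b) x := by
  unfold ricci
  have h1 := hG.contDiffAt_riemann
  fun_prop

lemma contDiffAt_ricciScalar : ContDiffAt ℝ ∞ (ricciScalar G) x := by
  exact ContDiffAt.sum fun a _ => ContDiffAt.sum fun b _ =>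
    (hG.contDiffAt_inv a b).mul (hG.contDiffAt_ricci a b)

lemma contDiffAt_scalarS : ContDiffAt ℝ ∞ (scalarS G) x := by
  unfold scalarS
  have h1 := hG.contDiffAt_ricciScalar
  fun_prop

lemma contDiffAt_phi (a b : Fin 3) : ContDiffAt ℝ ∞ (phi G a b) x := by
  unfold phi
  have h1 := hG.contDiffAt_ricciScalar
  have h2 := hG.contDiffAt_ricci
  have h3 := hG.smooth
  fun_prop

/-! ### Torsion-freeness and metric compatibility. -/

lemma christoffel_symm (c a b : Fin 3) (y : E3) :
    christoffel G c a b y = christoffel G c b a y := by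
  have : (fun z => G z a b) = fun z => G z b a := by ext z; exact hG.symm z a b
  unfold christoffel
  simp only [this]
  congr 1
  refine Finset.sum_congr rfl fun d _ => ?_
  ring

/-- Lowering the upper index of the Christoffel symbol. -/
lemma sum_mul_christoffel (d a b : Fin 3) :
    ∑ c, G x d c * christoffel G c a b x =
      (1 / 2) * (pd a (fun y => G y d b) x + pd b (fun y => G y d a) x
        - pd d (fun y => G y a b) x) := by
  set v : Fin 3 → ℂ := fun e => pd a (fun y => G y e b) x + pd b (fun y => G y e a) x
        - pd e (fun y => G y a b) x with hv
  have h : (G x *ᵥ ((G x)⁻¹ *ᵥ v)) d = v d := by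
    rw [Matrix.mulVec_mulVec, hG.mul_inv, Matrix.one_mulVec]
  rw [show pd a (fun y => G y d b) x + pd b (fun y => G y d a) x
        - pd d (fun y => G y a b) x = v d from rfl, ← h]
  simp only [Matrix.mulVec, dotProduct, Finset.mul_sum, christoffel, hv]
  refine Finset.sum_congr rfl fun _ _ => Finset.sum_congr rfl fun _ _ => ?_
  ring

/-- The Levi-Civita connection is metric. -/
lemma pd_eq_christoffel (c a b : Fin 3) :
    pd c (fun y => G y a b) x =
      ∑ d, christoffel G d c a x * G x d b + ∑ d, christoffel G d c b x * G x a d := by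
  have e1 : ∑ d, christoffel G d c a x * G x d b = ∑ d, G x b d * christoffel G d c a x :=
    Finset.sum_congr rfl fun d _ => by rw [hG.symm x d b]; ring
  have e2 : ∑ d, christoffel G d c b x * G x a d = ∑ d, G x a d * christoffel G d c b x :=
    Finset.sum_congr rfl fun d _ => by ring
  have s (i j : Fin 3) : (fun y => G y i j) = fun y => G y j i := by ext y; exact hG.symm y i j
  rw [e1, e2, hG.sum_mul_christoffel, hG.sum_mul_christoffel, s b a, s b c, s c b, s c a]
  ring

/-- The derivative of the inverse metric. -/
lemma pd_inv (a c d : Fin 3) :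
    pd a (fun y => (G y)⁻¹ c d) x =
      - ((G x)⁻¹ * Matrix.of (fun i j => pd a (fun y => G y i j) x) * (G x)⁻¹) c d := by
  set A : Matrix (Fin 3) (Fin 3) ℂ := Matrix.of fun i j => pd a (fun y => G y i j) x with hA
  set B : Matrix (Fin 3) (Fin 3) ℂ := Matrix.of fun i j => pd a (fun y => (G y)⁻¹ i j) x with hB
  have key : B * G x + (G x)⁻¹ * A = 0 := by
    ext i j
    -- Differentiate `G⁻¹ G = 1`, an identity available only on the neighbourhood where the
    -- determinant is nonzero.
    have h0 : pd a (fun y => ∑ k, (G y)⁻¹ i k * G y k j) x = 0 := by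
      rw [← pd_const (x := x) a ((1 : Matrix (Fin 3) (Fin 3) ℂ) i j)]
      refine pd_congr a (hG.eventually_det_ne.mono fun y hy => ?_)
      rw [← Matrix.nonsing_inv_mul _ (Ne.isUnit hy), Matrix.mul_apply]
    rw [pd_sum _ _ fun k _ => (hG.differentiableAt_inv i k).fun_mul (hG.differentiableAt k j)] at h0
    simp only [pd_mul a (hG.differentiableAt_inv _ _) (hG.differentiableAt _ _)] at h0
    rw [Finset.sum_add_distrib] at h0
    simpa [Matrix.mul_apply, hA, hB] using h0
  have h : B = - ((G x)⁻¹ * A * (G x)⁻¹) := by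
    have := congrArg (· * (G x)⁻¹) (eq_neg_of_add_eq_zero_left key)
    simpa [Matrix.mul_assoc, hG.mul_inv] using this
  exact congrFun (congrFun h c) d

/-! ### The contracted Christoffel symbol and the symmetry of the Ricci tensor. -/

lemma sum_christoffel_self (b : Fin 3) (y : E3) :
    ∑ c, christoffel G c c b y =
      (1 / 2) * ∑ c, ∑ d, (G y)⁻¹ c d * pd b (fun z => G z c d) y := by
  have s (i j : Fin 3) : (fun y => G y i j) = fun y => G y j i := by ext y; exact hG.symm y i j
  have hs : ∑ c, ∑ d, (G y)⁻¹ c d * pd c (fun z => G z d b) y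
      = ∑ c, ∑ d, (G y)⁻¹ c d * pd d (fun z => G z c b) y := by
    rw [Finset.sum_comm]
    exact Finset.sum_congr rfl fun d _ => Finset.sum_congr rfl fun c _ => by
      rw [hG.inv_symm]
  have hd : ∑ c, ∑ d, (G y)⁻¹ c d * pd b (fun z => G z d c) y
      = ∑ c, ∑ d, (G y)⁻¹ c d * pd b (fun z => G z c d) y :=
    Finset.sum_congr rfl fun c _ => Finset.sum_congr rfl fun d _ => by rw [s d c]
  simp only [christoffel, ← Finset.mul_sum, mul_sub, mul_add, Finset.sum_sub_distrib,
    Finset.sum_add_distrib]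
  rw [hs, hd]
  ring

/-- Morally `Γ^c_{cb} = ∂_b log √(det G)`, so this is equality of mixed partial derivatives. To
avoid a complex logarithm, both sides are expanded as half of `- tr(G⁻¹ ∂_a G G⁻¹ ∂_b G) + tr(G⁻¹
∂_a ∂_b G)`, symmetric by cyclicity of the trace and `pd_comm`. -/
lemma pd_sum_christoffel_symm (a b : Fin 3) :
    ∑ c, pd a (christoffel G c c b) x = ∑ c, pd b (christoffel G c c a) x := by
  have key (a b : Fin 3) : ∑ c, pd a (christoffel G c c b) x = (1 / 2) *
      (- (((G x)⁻¹ * Matrix.of (fun i j => pd a (fun y => G y i j) x)) *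
          ((G x)⁻¹ * Matrix.of (fun i j => pd b (fun y => G y i j) x))).trace
        + ∑ c, ∑ d, (G x)⁻¹ c d * pd a (pd b (fun z => G z c d)) x) := by
    have hp (i j k : Fin 3) : DifferentiableAt ℝ (pd i fun z => G z j k) x :=
      (contDiffAt_pd i (hG.smooth j k)).differentiableAt (by simp)
    have hi := hG.differentiableAt_inv
    have hd (c : Fin 3) : DifferentiableAt ℝ
        (fun y => ∑ d, (G y)⁻¹ c d * pd b (fun z => G z c d) y) x :=
      DifferentiableAt.fun_sum fun d _ => (hi c d).fun_mul (hp b c d)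
    rw [← pd_sum _ _ fun c _ =>
      (hG.contDiffAt_christoffel c c b).differentiableAt (by simp)]
    simp only [hG.sum_christoffel_self]
    rw [pd_const_mul _ _ (DifferentiableAt.fun_sum fun c _ => hd c), pd_sum _ _ fun c _ => hd c]
    congr 1
    have hc (c : Fin 3) : pd a (fun y => ∑ d, (G y)⁻¹ c d * pd b (fun z => G z c d) y) x =
        ∑ d, pd a (fun y => (G y)⁻¹ c d) x * pd b (fun z => G z c d) x
          + ∑ d, (G x)⁻¹ c d * pd a (pd b (fun z => G z c d)) x := by
      rw [pd_sum _ _ fun d _ => (hi c d).fun_mul (hp b c d), ← Finset.sum_add_distrib]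
      exact Finset.sum_congr rfl fun d _ => pd_mul a (hi c d) (hp b c d)
    rw [Finset.sum_congr rfl fun c _ => hc c, Finset.sum_add_distrib]
    congr 1
    rw [← Matrix.mul_assoc, Matrix.trace, ← Finset.sum_neg_distrib]
    refine Finset.sum_congr rfl fun c _ => ?_
    rw [Matrix.diag_apply, Matrix.mul_apply, ← Finset.sum_neg_distrib]
    refine Finset.sum_congr rfl fun d _ => ?_
    have s : (fun y => G y c d) = fun y => G y d c := by ext y; exact hG.symm y c d
    rw [hG.pd_inv, s]
    simp
  rw [key a b, key b a, Matrix.trace_mul_comm]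
  simp only [fun c d => pd_comm a b (hG.smooth c d)]

/-- Torsion-freeness and relabelling of summed indices settle every term except `∂_a Γ^c_{cb}`,
which is `pd_sum_christoffel_symm`. -/
lemma ricci_symm (a b : Fin 3) : ricci G a b x = ricci G b a x := by
  have hsymm (c a b : Fin 3) : christoffel G c a b = christoffel G c b a := by
    ext y; exact hG.christoffel_symm c a b y
  simp only [ricci, riemann, Finset.sum_add_distrib, Finset.sum_sub_distrib]
  rw [hG.pd_sum_christoffel_symm a b]
  have h1 : ∑ c, pd c (christoffel G c a b) x = ∑ c, pd c (christoffel G c b a) x := by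
    simp only [hsymm _ a b]
  have h2 : ∑ c, ∑ f, christoffel G c a f x * christoffel G f c b x
      = ∑ c, ∑ f, christoffel G c b f x * christoffel G f c a x := by
    rw [Finset.sum_comm]
    refine Finset.sum_congr rfl fun c _ => Finset.sum_congr rfl fun f _ => ?_
    rw [hsymm f a c, hsymm c f b]
    ring
  have h3 : ∑ c, ∑ f, christoffel G c c f x * christoffel G f a b x
      = ∑ c, ∑ f, christoffel G c c f x * christoffel G f b a x := by
    simp only [hsymm _ a b]
  rw [h1, h2, h3]

lemma phi_symm (a b : Fin 3) : phi G a b x = phi G b a x := by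
  rw [phi, phi, hG.ricci_symm a b, hG.symm x a b]

lemma phi_trace : ∑ a, ∑ b, (G x)⁻¹ a b * phi G a b x = 0 := by
  have h : ∑ a, ∑ b, (G x)⁻¹ a b * G x a b = 3 := by
    have := congrArg Matrix.trace hG.inv_mul
    simp only [Matrix.trace, Matrix.diag_apply, Matrix.mul_apply, Matrix.one_apply_eq] at this
    rw [Finset.sum_congr rfl fun a _ => Finset.sum_congr rfl fun b _ => by rw [hG.symm x a b],
      this]
    simp
  have h' : ∑ a, ∑ b, (G x)⁻¹ a b * phi G a b x
      = ricciScalar G x - (1 / 3) * ricciScalar G x *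
        ∑ a, ∑ b, (G x)⁻¹ a b * G x a b := by
    conv_rhs => rw [ricciScalar]
    simp only [phi, mul_sub, Finset.sum_sub_distrib, ricciScalar, Finset.mul_sum]
    congr 1
    refine Finset.sum_congr rfl fun a _ => Finset.sum_congr rfl fun b _ => ?_
    ring
  rw [h', h]
  ring

end IsMetricAt

/-! ### Bilinear forms in components -/

/-- The bilinear form `A_{ab} V^a W^b`. -/
def bil (A : Matrix (Fin 3) (Fin 3) ℂ) (V W : Fin 3 → ℂ) : ℂ := ∑ a, ∑ b, A a b * V a * W b

section Bil

variable (A : Matrix (Fin 3) (Fin 3) ℂ) (U V W : Fin 3 → ℂ) (r : ℂ)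

lemma bil_add_left : bil A (U + V) W = bil A U W + bil A V W := by
  simp only [bil, Pi.add_apply, ← Finset.sum_add_distrib]
  exact Finset.sum_congr rfl fun _ _ => Finset.sum_congr rfl fun _ _ => by ring

lemma bil_add_right : bil A U (V + W) = bil A U V + bil A U W := by
  simp only [bil, Pi.add_apply, ← Finset.sum_add_distrib]
  exact Finset.sum_congr rfl fun _ _ => Finset.sum_congr rfl fun _ _ => by ring

lemma bil_smul_left : bil A (r • V) W = r * bil A V W := by
  simp only [bil, Pi.smul_apply, smul_eq_mul, Finset.mul_sum]
  exact Finset.sum_congr rfl fun _ _ => Finset.sum_congr rfl fun _ _ => by ring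

lemma bil_smul_right : bil A V (r • W) = r * bil A V W := by
  simp only [bil, Pi.smul_apply, smul_eq_mul, Finset.mul_sum]
  exact Finset.sum_congr rfl fun _ _ => Finset.sum_congr rfl fun _ _ => by ring

variable {A} in
lemma bil_comm (hA : ∀ a b, A a b = A b a) : bil A V W = bil A W V := by
  unfold bil
  rw [Finset.sum_comm]
  exact Finset.sum_congr rfl fun b _ => Finset.sum_congr rfl fun a _ => by rw [hA a b]; ring

end Bil

/-- The matrix of the tracefree Ricci tensor. -/
def phiMatrix (G : E3 → Matrix (Fin 3) (Fin 3) ℂ) (x : E3) : Matrix (Fin 3) (Fin 3) ℂ :=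
  Matrix.of fun a b => phi G a b x

/-- The components of `∇_U V` at `x`. -/
def covDerivAlong (G : E3 → Matrix (Fin 3) (Fin 3) ℂ) (U : Fin 3 → ℂ) (V : E3 → Fin 3 → ℂ)
    (x : E3) : Fin 3 → ℂ :=
  fun c => ∑ a, U a * covDerivVec G V a c x

/-! ### Leibniz rules for the connection and the contracted Cotton tensor. -/

namespace IsMetricAt

variable {G : E3 → Matrix (Fin 3) (Fin 3) ℂ} {x : E3} (hG : IsMetricAt G x)

include hG

/-- If `g(Y, Z) = 0` near `x`, then `g(∇_U Y, Z) = - g(Y, ∇_U Z)` at `x`. -/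
lemma bil_covDerivAlong {Y Z : E3 → Fin 3 → ℂ}
    (hY : ∀ i, DifferentiableAt ℝ (fun y => Y y i) x)
    (hZ : ∀ i, DifferentiableAt ℝ (fun y => Z y i) x)
    (h : ∀ᶠ y in nhds x, bil (G y) (Y y) (Z y) = 0) (U : Fin 3 → ℂ) :
    bil (G x) (covDerivAlong G U Y x) (Z x) = - bil (G x) (Y x) (covDerivAlong G U Z x) := by
  have hd (a b : Fin 3) : DifferentiableAt ℝ (fun y => G y a b * Y y a * Z y b) x :=
    ((hG.differentiableAt a b).fun_mul (hY a)).fun_mul (hZ b)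
  have key (c : Fin 3) : ∑ a, ∑ b, (pd c (fun y => G y a b) x * Y x a * Z x b
      + G x a b * pd c (fun y => Y y a) x * Z x b
      + G x a b * Y x a * pd c (fun y => Z y b) x) = 0 := by
    have h0 : pd c (fun y => bil (G y) (Y y) (Z y)) x = 0 := by
      rw [← pd_const (x := x) c 0]
      exact pd_congr c h
    unfold bil at h0
    rw [pd_sum _ _ fun a _ => DifferentiableAt.fun_sum fun b _ => hd a b] at h0
    rw [← h0]
    refine Finset.sum_congr rfl fun a _ => ?_
    rw [pd_sum _ _ fun b _ => hd a b]
    refine Finset.sum_congr rfl fun b _ => ?_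
    rw [pd_mul c ((hG.differentiableAt a b).fun_mul (hY a)) (hZ b),
      pd_mul c (hG.differentiableAt a b) (hY a)]
    ring
  have hc (c : Fin 3) : bil (G x) (fun d => covDerivVec G Y c d x) (Z x)
      + bil (G x) (Y x) (fun d => covDerivVec G Z c d x) = 0 := by
    rw [← key c]
    simp only [hG.pd_eq_christoffel, bil, covDerivVec, Fin.sum_univ_three]
    ring
  have h1 : bil (G x) (covDerivAlong G U Y x) (Z x)
      = ∑ c, U c * bil (G x) (fun d => covDerivVec G Y c d x) (Z x) := by
    simp only [bil, covDerivAlong, Fin.sum_univ_three]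
    ring
  have h2 : bil (G x) (Y x) (covDerivAlong G U Z x)
      = ∑ c, U c * bil (G x) (Y x) (fun d => covDerivVec G Z c d x) := by
    simp only [bil, covDerivAlong, Fin.sum_univ_three]
    ring
  rw [← add_eq_zero_iff_eq_neg, h1, h2, ← Finset.sum_add_distrib]
  exact Finset.sum_eq_zero fun c _ => by rw [← mul_add, hc c, mul_zero]

/-- Differentiation of `Φ_{ca} k^a = 0`. -/
lemma sum_covDerivTensor_phi {k : E3 → Fin 3 → ℂ}
    (hk : ∀ i, DifferentiableAt ℝ (fun y => k y i) x)
    (h : ∀ᶠ y in nhds x, ∀ c, ∑ a, phi G c a y * k y a = 0) (b c : Fin 3) :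
    ∑ a, covDerivTensor G (phi G) b c a x * k x a
      = - ∑ d, phi G c d x * covDerivVec G k b d x := by
  have hd (a : Fin 3) : DifferentiableAt ℝ (phi G c a) x :=
    (hG.contDiffAt_phi c a).differentiableAt (by simp)
  have key : ∑ a, (pd b (phi G c a) x * k x a + phi G c a x * pd b (fun y => k y a) x) = 0 := by
    have h0 : pd b (fun y => ∑ a, phi G c a y * k y a) x = 0 := by
      rw [← pd_const (x := x) b 0]
      exact pd_congr b (h.mono fun y hy => hy c)
    rw [pd_sum _ _ fun a _ => (hd a).fun_mul (hk a)] at h0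
    rw [← h0]
    exact Finset.sum_congr rfl fun a _ => (pd_mul b (hd a) (hk a)).symm
  have h0 (d : Fin 3) := h.self_of_nhds d
  simp only [covDerivTensor, covDerivVec, Fin.sum_univ_three] at *
  -- The connection term on the contracted index is absorbed by `∇_b k`; the one on the free index
  -- `c` contains `Φ_{da} k^a`, which vanishes at `x`.
  linear_combination key - christoffel G 0 b c x * h0 0 - christoffel G 1 b c x * h0 1
    - christoffel G 2 b c x * h0 2

/-- Since `∇g = 0`, only `S` is differentiated in the trace part of the Schouten tensor. -/
lemma covDerivTensor_schouten (c a b : Fin 3) :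
    covDerivTensor G (schouten G) c a b x =
      - covDerivTensor G (phi G) c a b x - pd c (scalarS G) x * G x a b := by
  have hP : DifferentiableAt ℝ (phi G a b) x :=
    (hG.contDiffAt_phi a b).differentiableAt (by simp)
  have hS : DifferentiableAt ℝ (scalarS G) x := hG.contDiffAt_scalarS.differentiableAt (by simp)
  have e : pd c (schouten G a b) x = - pd c (phi G a b) x
      - (pd c (scalarS G) x * G x a b + scalarS G x * pd c (fun y => G y a b) x) := by
    rw [← pd_neg, ← pd_mul c hS (hG.differentiableAt a b),
      ← pd_sub c hP.fun_neg (hS.fun_mul (hG.differentiableAt a b))]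
    rfl
  rw [covDerivTensor, e, hG.pd_eq_christoffel]
  simp only [covDerivTensor, schouten, Fin.sum_univ_three]
  ring

/-- The contraction of the Cotton tensor with a vector field annihilated by `Φ`. -/
lemma sum_cotton {k : E3 → Fin 3 → ℂ}
    (hk : ∀ i, DifferentiableAt ℝ (fun y => k y i) x)
    (h : ∀ᶠ y in nhds x, ∀ c, ∑ a, phi G c a y * k y a = 0) (U V : Fin 3 → ℂ) :
    ∑ a, ∑ b, ∑ c, cotton G a b c x * k x a * U b * V c =
      bil (phiMatrix G x) V (covDerivAlong G U k x)
        - bil (phiMatrix G x) U (covDerivAlong G V k x)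
        + (bil (G x) (k x) U * ∑ c, V c * pd c (scalarS G) x
          - bil (G x) (k x) V * ∑ b, U b * pd b (scalarS G) x) := by
  have e1 : ∑ a, ∑ b, ∑ c, cotton G a b c x * k x a * U b * V c =
      (∑ b, ∑ c, (∑ a, covDerivTensor G (phi G) c b a x * k x a) * U b * V c)
      - (∑ b, ∑ c, (∑ a, covDerivTensor G (phi G) b c a x * k x a) * U b * V c)
      + (bil (G x)ᵀ (k x) U * ∑ c, V c * pd c (scalarS G) x
          - bil (G x)ᵀ (k x) V * ∑ b, U b * pd b (scalarS G) x) := by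
    simp only [cotton, hG.covDerivTensor_schouten, bil, Matrix.transpose_apply, Fin.sum_univ_three]
    ring
  rw [e1]
  have hT : (G x)ᵀ = G x := by
    ext a b
    exact hG.symm x b a
  simp only [hG.sum_covDerivTensor_phi hk h, hT]
  have e2 : ∑ b, ∑ c, -(∑ d, phi G b d x * covDerivVec G k c d x) * U b * V c
      = - bil (phiMatrix G x) U (covDerivAlong G V k x) := by
    simp only [bil, phiMatrix, Matrix.of_apply, covDerivAlong, Fin.sum_univ_three]
    ring
  have e3 : ∑ b, ∑ c, -(∑ d, phi G c d x * covDerivVec G k b d x) * U b * V c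
      = - bil (phiMatrix G x) V (covDerivAlong G U k x) := by
    simp only [bil, phiMatrix, Matrix.of_apply, covDerivAlong, Fin.sum_univ_three]
    ring
  rw [e2, e3]
  ring

end IsMetricAt

/-! ### Null frames in components -/

/-- The components of a null frame of the symmetric bilinear form `A`. -/
structure IsNullFrame (A : Matrix (Fin 3) (Fin 3) ℂ) (k l n : Fin 3 → ℂ) : Prop where
  symm : ∀ a b, A a b = A b a
  kk : bil A k k = 0
  ll : bil A l l = 0
  kl : bil A k l = 1
  kn : bil A k n = 0
  ln : bil A l n = 0
  nn : bil A n n = -(1 / 2)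

namespace IsNullFrame

variable {A : Matrix (Fin 3) (Fin 3) ℂ} {k l n : Fin 3 → ℂ} (h : IsNullFrame A k l n)

include h

lemma lk : bil A l k = 1 := by rw [bil_comm _ _ h.symm, h.kl]
lemma nk : bil A n k = 0 := by rw [bil_comm _ _ h.symm, h.kn]
lemma nl : bil A n l = 0 := by rw [bil_comm _ _ h.symm, h.ln]

/-- This is `g^{ab} = 2 k^{(a} ℓ^{b)} - 2 n^a n^b`: with the frame as the rows of `F`, the Gram
matrix `F A Fᵀ` is known, and the constant matrix here is its inverse. Non-degeneracy, the trace
formula and the frame expansion all follow from it. -/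
lemma mul_eq_one : A * ((Matrix.of ![k, l, n])ᵀ * !![0, 1, 0; 1, 0, 0; 0, 0, -2]
    * Matrix.of ![k, l, n]) = 1 := by
  have hF : Matrix.of ![k, l, n] * (A * (Matrix.of ![k, l, n])ᵀ *
      !![0, 1, 0; 1, 0, 0; 0, 0, -2]) = 1 := by
    have hA : Matrix.of ![k, l, n] * A * (Matrix.of ![k, l, n])ᵀ
        = !![0, 1, 0; 1, 0, 0; 0, 0, -(1 / 2)] := by
      have e (V W : Fin 3 → ℂ) : ∑ b, (∑ a, V a * A a b) * W b = bil A V W := by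
        simp only [bil, Fin.sum_univ_three]
        ring
      ext i j
      simp only [Matrix.mul_apply, Matrix.transpose_apply, Matrix.of_apply, e]
      fin_cases i <;> fin_cases j <;>
        simp [h.kk, h.ll, h.kl, h.kn, h.ln, h.nn, h.lk, h.nk, h.nl]
    rw [← Matrix.mul_assoc, ← Matrix.mul_assoc, hA]
    ext i j
    fin_cases i <;> fin_cases j <;> simp [Matrix.mul_apply, Fin.sum_univ_three]
  -- For square matrices a right inverse is a left inverse, which carries `F` from the left end of
  -- the product to the right.
  have := mul_eq_one_comm.mp hF
  simpa only [Matrix.mul_assoc] using this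

lemma det_ne_zero : A.det ≠ 0 := fun h0 => by
  have := congrArg Matrix.det h.mul_eq_one
  rw [Matrix.det_mul, h0] at this
  simp at this

lemma inv_eq : A⁻¹ = (Matrix.of ![k, l, n])ᵀ * !![0, 1, 0; 1, 0, 0; 0, 0, -2]
    * Matrix.of ![k, l, n] := Matrix.inv_eq_right_inv h.mul_eq_one

/-- The trace of a symmetric form in a null frame. -/
lemma trace_eq {B : Matrix (Fin 3) (Fin 3) ℂ} (hB : ∀ a b, B a b = B b a) :
    ∑ a, ∑ b, A⁻¹ a b * B a b = 2 * bil B k l - 2 * bil B n n := by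
  rw [h.inv_eq]
  simp [Matrix.mul_apply, bil, Fin.sum_univ_three, Matrix.transpose_apply]
  rw [hB 1 0, hB 2 0, hB 2 1]
  ring

/-- The expansion of a vector in a null frame. -/
lemma expansion (V : Fin 3 → ℂ) :
    V = bil A V l • k + bil A V k • l + (-2 * bil A V n) • n := by
  have h1 := mul_eq_one_comm.mp h.mul_eq_one
  have h2 := congrArg (fun Q => Q *ᵥ V) h1
  simp only [Matrix.one_mulVec] at h2
  conv_lhs => rw [← h2]
  rw [bil_comm V l h.symm, bil_comm V k h.symm, bil_comm V n h.symm]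
  ext i
  simp [Matrix.mul_apply, Matrix.mulVec, dotProduct, bil, Fin.sum_univ_three,
    Matrix.transpose_apply]
  ring

lemma expansion_of_perp {V : Fin 3 → ℂ} (hV : bil A V k = 0) :
    V = bil A V l • k + (-2 * bil A V n) • n := by
  conv_lhs => rw [h.expansion V, hV, zero_smul, add_zero]

end IsNullFrame

/-! ### The quartic form -/

/-- A binary quartic is determined by its values at five distinct points of the projective line. -/
lemma quartic_coeff_eq_zero {a b c d e : ℂ}
    (h : ∀ u v : ℂ, a * u ^ 4 + b * u ^ 3 * v + c * u ^ 2 * v ^ 2 + d * u * v ^ 3 + e * v ^ 4 = 0) :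
    a = 0 ∧ b = 0 ∧ c = 0 ∧ d = 0 ∧ e = 0 := by
  have h1 := h 1 0
  have h2 := h 0 1
  have h3 := h 1 1
  have h4 := h 1 (-1)
  have h5 := h 1 2
  have ha : a = 0 := by linear_combination h1
  have he : e = 0 := by linear_combination h2
  have hc : c = 0 := by linear_combination h3 / 2 + h4 / 2 - ha - he
  have hd : d = 0 := by linear_combination h5 / 6 - h3 / 3 + ha / 6 - hc / 3 - 7 / 3 * he
  refine ⟨ha, ?_, hc, hd, he⟩
  linear_combination h3 - ha - hc - hd - he

/-- Quadratic forms `L`, `M`, `N` with `N² = L M` such that `L (c₀ M + c₁ N + c₂ L)` has the root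
multiplicities `{3, 1}`. -/
lemma coeff_of_triple_root {A B C A' B' C' a b c c₀ c₁ c₂ : ℂ}
    (h1 : ∀ u v : ℂ, u ^ 3 * v = (A * u ^ 2 + B * u * v + C * v ^ 2) *
      (c₀ * (A' * u ^ 2 + B' * u * v + C' * v ^ 2) + c₁ * (a * u ^ 2 + b * u * v + c * v ^ 2)
        + c₂ * (A * u ^ 2 + B * u * v + C * v ^ 2)))
    (h2 : ∀ u v : ℂ, (a * u ^ 2 + b * u * v + c * v ^ 2) ^ 2 =
      (A * u ^ 2 + B * u * v + C * v ^ 2) * (A' * u ^ 2 + B' * u * v + C' * v ^ 2)) :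
    c₀ = 0 ∧ c₁ ≠ 0 := by
  -- `D`, `E`, `F` are the coefficients of the cofactor of `L`. Below, the `p`s are the coefficients
  -- of `L · (cofactor) = u³ v`, and the `q`s those of `N² = L M`.
  obtain ⟨D, hD⟩ : ∃ D, D = c₀ * A' + c₁ * a + c₂ * A := ⟨_, rfl⟩
  obtain ⟨E, hE⟩ : ∃ E, E = c₀ * B' + c₁ * b + c₂ * B := ⟨_, rfl⟩
  obtain ⟨F, hF⟩ : ∃ F, F = c₀ * C' + c₁ * c + c₂ * C := ⟨_, rfl⟩
  obtain ⟨p0, p1, p2, p3, p4⟩ := quartic_coeff_eq_zero (a := A * D) (b := A * E + B * D - 1)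
    (c := A * F + B * E + C * D) (d := B * F + C * E) (e := C * F) fun u v => by
      rw [hD, hE, hF]; linear_combination -h1 u v
  obtain ⟨q0, q1, q2, q3, q4⟩ := quartic_coeff_eq_zero (a := a ^ 2 - A * A')
    (b := 2 * a * b - A * B' - B * A')
    (c := b ^ 2 + 2 * a * c - A * C' - B * B' - C * A') (d := 2 * b * c - B * C' - C * B')
    (e := c ^ 2 - C * C') fun u v => by linear_combination h2 u v
  -- If `L` did not vanish at `u = 0`, then `u³` would divide the quadratic cofactor, forcing it to
  -- be zero.
  have hC : C = 0 := by
    by_contra hC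
    have hF0 : F = 0 := by simpa [hC] using p4
    have hE0 : E = 0 := by simpa [hC, hF0] using p3
    have hD0 : D = 0 := by simpa [hC, hF0, hE0] using p2
    simp [hE0, hD0] at p1
  subst hC
  have hc : c = 0 := by simpa using q4
  subst hc
  -- If `u = 0` were a simple root of `L`, then `L` would be a multiple of `u v` and the cofactor of
  -- `u²`. But `N² = L M` then makes both `N` and `M` vanish at `v = 0`, and so the cofactor as
  -- well.
  have hB : B = 0 := by
    by_contra hB
    have hF0 : F = 0 := by simpa [hB] using p3
    have hE0 : E = 0 := by simpa [hB, hF0] using p2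
    have hD1 : B * D = 1 := by
      rw [hE0] at p1
      linear_combination p1
    have hD0 : D ≠ 0 := right_ne_zero_of_mul_eq_one hD1
    have hA : A = 0 := by simpa [hD0] using p0
    subst hA
    have ha : a = 0 := by simpa using q0
    subst ha
    have hA' : A' = 0 := by simpa [hB] using q1
    exact hD0 (by rw [hD, hA']; ring)
  subst hB
  have hAE : A * E = 1 := by linear_combination p1
  have hA : A ≠ 0 := left_ne_zero_of_mul_eq_one hAE
  have hE0 : E ≠ 0 := right_ne_zero_of_mul_eq_one hAE
  have hF0 : F = 0 := by simpa [hA] using p2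
  -- Now `L = A u²` and the cofactor is `E u v`. If `c₀ ≠ 0`, its vanishing at `u = 0` passes to
  -- `M`; then `N² = L M` kills the `u v` coefficients of `N` and of `M`, against `E ≠ 0`.
  have h0 : c₀ = 0 := by
    by_contra h0
    have hC' : C' = 0 := by
      have : c₀ * C' = 0 := by rw [← hF0, hF]; ring
      simpa [h0] using this
    subst hC'
    have hb : b = 0 := by simpa using q2
    subst hb
    have hB' : B' = 0 := by simpa [hA] using q1
    exact hE0 (by rw [hE, hB']; ring)
  refine ⟨h0, fun hc1 => hE0 ?_⟩
  rw [hE, h0, hc1]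
  ring

/-- The components of `s² k + 2 s t n + t² ℓ`. -/
def nullVec (k l n : Fin 3 → ℂ) (s t : ℂ) : Fin 3 → ℂ :=
  s ^ 2 • k + (2 * s * t) • n + t ^ 2 • l

lemma bil_nullVec_self {A : Matrix (Fin 3) (Fin 3) ℂ} (hA : ∀ a b, A a b = A b a) (k l n : Fin 3 → ℂ)
    (s t : ℂ) : bil A (nullVec k l n s t) (nullVec k l n s t) =
      bil A k k * s ^ 4 + 4 * bil A k n * s ^ 3 * t
        + (4 * bil A n n + 2 * bil A k l) * s ^ 2 * t ^ 2
        + 4 * bil A l n * s * t ^ 3 + bil A l l * t ^ 4 := by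
  simp only [nullVec, bil_add_left, bil_add_right, bil_smul_left, bil_smul_right]
  rw [bil_comm n k hA, bil_comm l k hA, bil_comm n l hA]
  ring

lemma bil_nullVec_left (A : Matrix (Fin 3) (Fin 3) ℂ) (k l n V : Fin 3 → ℂ) (s t : ℂ) :
    bil A (nullVec k l n s t) V = s ^ 2 * bil A k V + 2 * s * t * bil A n V + t ^ 2 * bil A l V := by
  simp only [nullVec, bil_add_left, bil_smul_left]

/-- In a frame adapted to a multiple principal null direction, a tracefree form whose quartic has
the root multiplicities `{3, 1}` has `Φ₀ = Φ₁ = Φ₂ = 0` and `Φ₃ ≠ 0`. -/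
theorem adapted_components {G P : Matrix (Fin 3) (Fin 3) ℂ}
    {k₁ l₁ n₁ k l n : Fin 3 → ℂ} (F₁ : IsNullFrame G k₁ l₁ n₁) (F : IsNullFrame G k l n)
    (hP : ∀ a b, P a b = P b a) (htr : ∑ a, ∑ b, G⁻¹ a b * P a b = 0)
    {α β : Fin 2 → ℂ} (hαβ : α 0 * β 1 - α 1 * β 0 ≠ 0)
    (hIII : ∀ s t : ℂ, (1 / 2) * bil P (nullVec k₁ l₁ n₁ s t) (nullVec k₁ l₁ n₁ s t) =
      (α 0 * s + α 1 * t) ^ 3 * (β 0 * s + β 1 * t))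
    {c₀ c₁ c₂ : ℂ}
    (hmp : ∀ s t : ℂ, (1 / 2) * bil P (nullVec k l n s t) (nullVec k l n s t) =
      t ^ 2 * (c₀ * s ^ 2 + c₁ * s * t + c₂ * t ^ 2)) :
    (∀ V, bil P V k = 0) ∧ bil P n n = 0 ∧ bil P l n ≠ 0 := by
  obtain ⟨r0, r1, r2, r3, r4⟩ := quartic_coeff_eq_zero (a := bil P k k) (b := 4 * bil P k n)
    (c := 4 * bil P n n + 2 * bil P k l - 2 * c₀) (d := 4 * bil P l n - 2 * c₁)
    (e := bil P l l - 2 * c₂) fun s t => by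
      linear_combination 2 * hmp s t - bil_nullVec_self hP k l n s t
  have hkn : bil P k n = 0 := by simpa using r1
  -- This is the tracefree condition in the adapted frame.
  have hkl : bil P k l = bil P n n := by linear_combination (F.trace_eq hP).symm / 2 + htr / 2
  have hnull (s t : ℂ) : bil G (nullVec k₁ l₁ n₁ s t) (nullVec k₁ l₁ n₁ s t) = 0 := by
    rw [bil_nullVec_self F₁.symm, F₁.kk, F₁.kn, F₁.nn, F₁.kl, F₁.ln, F₁.ll]
    ring
  -- For `V = nullVec k l n s t` the products with `ℓ`, `k`, `n` are `s²`, `t²`, `-s t`. Writing the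
  -- quartic in these products, whence the sign of `c₁`, makes sense for every null `V` without
  -- extracting square roots for `s` and `t`, so it can be evaluated on the null vectors of the
  -- other frame.
  have hquad {V : Fin 3 → ℂ} (hV : bil G V V = 0) :
      bil G V n ^ 2 = bil G V k * bil G V l ∧
      (1 / 2) * bil P V V = bil G V k *
        (c₀ * bil G V l + (-c₁) * bil G V n + c₂ * bil G V k) := by
    set x := bil G V l
    set y := bil G V k
    set z := bil G V n
    have hN : z ^ 2 = y * x := by
      rw [F.expansion V] at hV
      simp only [bil_add_left, bil_add_right, bil_smul_left, bil_smul_right, F.kk, F.ll, F.kl,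
        F.kn, F.ln, F.nn, F.lk, F.nk, F.nl] at hV
      linear_combination -hV / 2
    refine ⟨hN, ?_⟩
    rw [F.expansion V]
    simp only [bil_add_left, bil_add_right, bil_smul_left, bil_smul_right]
    rw [bil_comm n k hP, bil_comm l k hP, bil_comm n l hP, hkn, r0]
    linear_combination 2 * bil P n n * hN + y * x * r2 / 2 - y * z * r3 / 2 + y ^ 2 * r4 / 2
  -- Cramer's rule inverts `u = α 0 s + α 1 t`, `v = β 0 s + β 1 t`, so that the type III quartic
  -- becomes `u³ v`. Products of `nullVec` with fixed vectors are then quadratic forms in `u` and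
  -- `v`.
  have hsub (p q r : ℂ) : ∃ A B C : ℂ, ∀ u v : ℂ,
      ((β 1 * u - α 1 * v) / (α 0 * β 1 - α 1 * β 0)) ^ 2 * p
      + 2 * ((β 1 * u - α 1 * v) / (α 0 * β 1 - α 1 * β 0))
        * ((α 0 * v - β 0 * u) / (α 0 * β 1 - α 1 * β 0)) * q
      + ((α 0 * v - β 0 * u) / (α 0 * β 1 - α 1 * β 0)) ^ 2 * r
      = A * u ^ 2 + B * u * v + C * v ^ 2 := by
    generalize α 0 * β 1 - α 1 * β 0 = d
    exact ⟨(β 1 ^ 2 * p - 2 * β 1 * β 0 * q + β 0 ^ 2 * r) / d ^ 2,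
      (-2 * β 1 * α 1 * p + 2 * (β 1 * α 0 + α 1 * β 0) * q - 2 * α 0 * β 0 * r) / d ^ 2,
      (α 1 ^ 2 * p - 2 * α 1 * α 0 * q + α 0 ^ 2 * r) / d ^ 2, fun u v => by ring⟩
  obtain ⟨A, B, C, hL⟩ := hsub (bil G k₁ k) (bil G n₁ k) (bil G l₁ k)
  obtain ⟨A', B', C', hM⟩ := hsub (bil G k₁ l) (bil G n₁ l) (bil G l₁ l)
  obtain ⟨a, b, c, hN⟩ := hsub (bil G k₁ n) (bil G n₁ n) (bil G l₁ n)
  obtain ⟨h0, h1⟩ := coeff_of_triple_root (A := A) (B := B) (C := C) (A' := A') (B' := B')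
    (C' := C') (a := a) (b := b) (c := c) (c₀ := c₀) (c₁ := -c₁) (c₂ := c₂)
    (fun u v => by
      rw [← hL, ← hM, ← hN, ← bil_nullVec_left, ← bil_nullVec_left, ← bil_nullVec_left,
        ← (hquad (hnull _ _)).2, hIII]
      congr 1
      · congr 1
        rw [mul_div_assoc', mul_div_assoc', ← add_div, eq_div_iff hαβ]
        ring
      · rw [mul_div_assoc', mul_div_assoc', ← add_div, eq_div_iff hαβ]
        ring)
    (fun u v => by
      rw [← hL, ← hM, ← hN, ← bil_nullVec_left, ← bil_nullVec_left, ← bil_nullVec_left]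
      exact (hquad (hnull _ _)).1)
  have hnn : bil P n n = 0 := by linear_combination (r2 + 2 * h0 - 2 * hkl) / 6
  refine ⟨fun V => ?_, hnn, fun hln => h1 ?_⟩
  · rw [F.expansion V]
    simp only [bil_add_left, bil_smul_left]
    rw [bil_comm n k hP, bil_comm l k hP, hkn, r0, hkl, hnn]
    ring
  · linear_combination (r3 - 4 * hln) / 2

/-- The algebraic core: if `U ↦ Φ(V, w(U))` is symmetric for vectors `w(U), w(V)` orthogonal to `k`,
then `w(U)` is orthogonal to the complement of `k` for every `U` orthogonal to `k`. -/
theorem bil_eq_zero_of_symm {G P : Matrix (Fin 3) (Fin 3) ℂ}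
    {k l n : Fin 3 → ℂ} (F : IsNullFrame G k l n) (hP : ∀ V, bil P V k = 0)
    (hPsymm : ∀ a b, P a b = P b a)
    (hnn : bil P n n = 0) (hln : bil P l n ≠ 0) {w : (Fin 3 → ℂ) → Fin 3 → ℂ}
    (hw : ∀ U, bil G (w U) k = 0) {X Y : Fin 3 → ℂ} (hsymm : bil P l (w X) = bil P X (w l))
    (hX : bil G X k = 0) (hY : bil G Y k = 0) : bil G Y (w X) = 0 := by
  have hkn : bil P k n = 0 := by rw [bil_comm k n hPsymm, hP]
  have hXn : bil P X n = 0 := by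
    rw [F.expansion_of_perp hX]
    simp only [bil_add_left, bil_smul_left, hnn, hkn]
    ring
  -- Both `w X` and `w l` lie in the span of `k` and `n`, and `Φ` kills `k`. The right side vanishes
  -- by `hXn`; the left is `-2 g(w X, n) Φ(ℓ, n)`.
  rw [F.expansion_of_perp (hw X), F.expansion_of_perp (hw l)] at hsymm
  simp only [bil_add_right, bil_smul_right, hP, hXn] at hsymm
  have hz : bil G (w X) n = 0 := by simpa [hln] using hsymm
  rw [F.expansion_of_perp (hw X), hz, F.expansion_of_perp hY]
  simp only [bil_add_left, bil_add_right, bil_smul_left, bil_smul_right, F.kk, F.nk]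
  ring

/-! ### Passage to a chart -/

variable {M : Type*} [TopologicalSpace M] [ChartedSpace E3 M]

/-- The differential of a chart, with values in the model space. -/
def chartDeriv (e : OpenPartialHomeomorph M E3) (p : M) : TangentSpace 𝓘(ℝ, E3) p →L[ℝ] E3 :=
  mfderiv 𝓘(ℝ, E3) 𝓘(ℝ, E3) e p

/-- The differential of the inverse of a chart, defined on the model space. -/
def chartSymmDeriv (e : OpenPartialHomeomorph M E3) (x : E3) :
    E3 →L[ℝ] TangentSpace 𝓘(ℝ, E3) (e.symm x) :=
  mfderiv 𝓘(ℝ, E3) 𝓘(ℝ, E3) e.symm x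

section Comp

variable (e : OpenPartialHomeomorph M E3) {p : M}

lemma comp_add (V W : CTangent p) : comp e (V + W) = comp e V + comp e W := by
  ext i
  simp [comp]

lemma comp_smul (r : ℂ) (V : CTangent p) : comp e (r • V) = r • comp e V := by
  ext i
  simp [comp]

lemma comp_zero : comp e (0 : CTangent p) = 0 := by
  ext i
  simp [comp]

lemma comp_tmul (r : ℂ) (v : TangentSpace 𝓘(ℝ, E3) p) (i : Fin 3) :
    comp e (r ⊗ₜ[ℝ] v) i = r * (chartDeriv e p v i : ℂ) := by
  simp only [comp, LinearMap.liftBaseChange_tmul]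
  rfl

end Comp

lemma complexify_tmul {p : M}
    (B : TangentSpace 𝓘(ℝ, E3) p →L[ℝ] TangentSpace 𝓘(ℝ, E3) p →L[ℝ] ℂ) (r s : ℂ)
    (v w : TangentSpace 𝓘(ℝ, E3) p) :
    complexify B (r ⊗ₜ[ℝ] v) (s ⊗ₜ[ℝ] w) = r * s * B v w := by
  simp [complexify]
  ring

variable [IsManifold 𝓘(ℝ, E3) ∞ M]

/-- The coordinate components of a smooth real vector field are smooth. -/
lemma contDiffAt_mfderiv_chart {e : OpenPartialHomeomorph M E3} (he : e ∈ atlas E3 M)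
    {X : ∀ p : M, TangentSpace 𝓘(ℝ, E3) p} {U : Set M} (hU : IsOpen U)
    (hX : ContMDiffOn 𝓘(ℝ, E3) 𝓘(ℝ, E3).tangent ∞
      (fun p => (⟨p, X p⟩ : TangentBundle 𝓘(ℝ, E3) M)) U)
    {x : E3} (hx : x ∈ e.target) (hxU : e.symm x ∈ U) :
    ContDiffAt ℝ ∞
      (fun y => chartDeriv e (e.symm y) (X (e.symm y))) x := by
  have hem : e ∈ IsManifold.maximalAtlas 𝓘(ℝ, E3) ∞ M := IsManifold.subset_maximalAtlas he
  have h1 : ContMDiffOn 𝓘(ℝ, E3).tangent 𝓘(ℝ, E3).tangent ∞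
      (tangentMapWithin 𝓘(ℝ, E3) 𝓘(ℝ, E3) e e.source) _ :=
    (contMDiffOn_of_mem_maximalAtlas hem).contMDiffOn_tangentMapWithin (m := ∞) (by simp)
      e.open_source.uniqueMDiffOn
  have hsymm : ContMDiffAt 𝓘(ℝ, E3) 𝓘(ℝ, E3) ∞ e.symm x :=
    contMDiffAt_symm_of_mem_maximalAtlas hem hx
  have h2 : ContMDiffAt 𝓘(ℝ, E3) 𝓘(ℝ, E3).tangent ∞
      (fun y => (⟨e.symm y, X (e.symm y)⟩ : TangentBundle 𝓘(ℝ, E3) M)) x :=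
    (hX.contMDiffAt (hU.mem_nhds hxU)).comp x hsymm
  -- The chart is smooth only on its source, hence the tangent map within that open set; it agrees
  -- there with the ordinary one.
  have h3 : ContMDiffAt 𝓘(ℝ, E3) 𝓘(ℝ, E3).tangent ∞
      (fun y => tangentMapWithin 𝓘(ℝ, E3) 𝓘(ℝ, E3) e e.source
        (⟨e.symm y, X (e.symm y)⟩ : TangentBundle 𝓘(ℝ, E3) M)) x := by
    refine ContMDiffAt.comp x (h1.contMDiffAt ?_) h2
    refine (e.open_source.preimage
      (FiberBundle.continuous_proj E3 (TangentSpace 𝓘(ℝ, E3)))).mem_nhds ?_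
    exact e.map_target hx
  refine contMDiffAt_vectorSpace_iff_contDiffAt.mp ?_
  refine h3.congr_of_eventuallyEq ?_
  filter_upwards [e.open_target.mem_nhds hx] with y hy
  rw [tangentMapWithin_eq_tangentMap (e.open_source.uniqueMDiffWithinAt (e.map_target hy))]
  · unfold tangentMap
    dsimp only
    rw [e.right_inv hy]
    rfl
  · exact ((contMDiffOn_of_mem_maximalAtlas hem).contMDiffAt
      (e.open_source.mem_nhds (e.map_target hy))).mdifferentiableAt (by simp)

/-- The coordinate components of a smooth complex vector field are smooth. -/
lemma contDiffAt_comp {e : OpenPartialHomeomorph M E3} (he : e ∈ atlas E3 M)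
    {V : ∀ p : M, CTangent p} {U : Set M} (hU : IsOpen U) (hV : SmoothFieldOn V U)
    {x : E3} (hx : x ∈ e.target) (hxU : e.symm x ∈ U) (i : Fin 3) :
    ContDiffAt ℝ ∞ (fun y => comp e (V (e.symm y)) i) x := by
  obtain ⟨X, Y, hX, hY, hVXY⟩ := hV
  have hre {X : ∀ p : M, TangentSpace 𝓘(ℝ, E3) p}
      (hX : ContMDiffOn 𝓘(ℝ, E3) 𝓘(ℝ, E3).tangent ∞
        (fun p => (⟨p, X p⟩ : TangentBundle 𝓘(ℝ, E3) M)) U) :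
      ContDiffAt ℝ ∞ (fun y =>
        (chartDeriv e (e.symm y) (X (e.symm y)) i : ℂ)) x :=
    (Complex.ofRealCLM ∘L (EuclideanSpace.proj i : E3 →L[ℝ] ℝ)).contDiff.contDiffAt.comp x
      (contDiffAt_mfderiv_chart he hU hX hx hxU)
  refine ContDiffAt.congr_of_eventuallyEq
    ((hre hX).add (contDiffAt_const (c := Complex.I) |>.mul (hre hY))) ?_
  filter_upwards [e.open_target.mem_nhds hx,
    (e.continuousAt_symm hx).preimage_mem_nhds (hU.mem_nhds hxU)] with y hy hyU
  rw [hVXY _ hyU, comp_add, Pi.add_apply, comp_tmul, comp_tmul, one_mul]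

/-! ### The metric and its curvature in a chart. -/

namespace ComplexMetric

variable (g : ComplexMetric M)

/-- The metric in a chart is smooth. -/
lemma contDiffAt_matrix {e : OpenPartialHomeomorph M E3} (he : e ∈ atlas E3 M) {x : E3}
    (hx : x ∈ e.target) (i j : Fin 3) : ContDiffAt ℝ ∞ (fun y => g.matrix e y i j) x := by
  have hem : e ∈ IsManifold.maximalAtlas 𝓘(ℝ, E3) ∞ M := IsManifold.subset_maximalAtlas he
  have hsymm : ContMDiffAt 𝓘(ℝ, E3) 𝓘(ℝ, E3) ∞ e.symm x :=
    contMDiffAt_symm_of_mem_maximalAtlas hem hx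
  -- The coordinate field `∂_i` is the image of a constant field under the tangent map of `e.symm`,
  -- hence smooth along `e.symm`.
  have hpd (i : Fin 3) : ContMDiffAt 𝓘(ℝ, E3) 𝓘(ℝ, E3).tangent ∞
      (fun y => (⟨e.symm y, mfderiv 𝓘(ℝ, E3) 𝓘(ℝ, E3) e.symm y
        (EuclideanSpace.single i (1 : ℝ))⟩ : TangentBundle 𝓘(ℝ, E3) M)) x := by
    have h1 := (contMDiffOn_symm_of_mem_maximalAtlas hem).contMDiffOn_tangentMapWithin (m := ∞)
      (by simp) e.open_target.uniqueMDiffOn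
    have h2 : ContMDiffAt 𝓘(ℝ, E3) 𝓘(ℝ, E3).tangent ∞
        (fun y : E3 => (⟨y, (EuclideanSpace.single i (1 : ℝ) : E3)⟩ :
          TangentBundle 𝓘(ℝ, E3) E3)) x :=
      contMDiffAt_vectorSpace_iff_contDiffAt.mpr contDiffAt_const
    have h3 := ContMDiffAt.comp x (h1.contMDiffAt ((e.open_target.preimage
      (FiberBundle.continuous_proj E3 (TangentSpace 𝓘(ℝ, E3)))).mem_nhds hx)) h2
    refine h3.congr_of_eventuallyEq ?_
    filter_upwards [e.open_target.mem_nhds hx] with y hy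
    rw [Function.comp_apply,
      tangentMapWithin_eq_tangentMap (e.open_target.uniqueMDiffWithinAt hy)]
    · rfl
    · exact ((contMDiffOn_symm_of_mem_maximalAtlas hem).contMDiffAt
        (e.open_target.mem_nhds hy)).mdifferentiableAt (by simp)
  have h : ContMDiffAt 𝓘(ℝ, E3) (𝓘(ℝ, E3).prod 𝓘(ℝ, ℂ)) ∞
      (fun y => Bundle.TotalSpace.mk' ℂ (E := Bundle.Trivial M ℂ) (e.symm y)
        (g.form (e.symm y)
          (mfderiv 𝓘(ℝ, E3) 𝓘(ℝ, E3) e.symm y (EuclideanSpace.single i (1 : ℝ)))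
          (mfderiv 𝓘(ℝ, E3) 𝓘(ℝ, E3) e.symm y (EuclideanSpace.single j (1 : ℝ))))) x := by
    apply ContMDiffAt.clm_bundle_apply₂ (F₁ := E3) (F₂ := E3)
    · exact ContMDiffAt.comp x g.smooth.contMDiffAt hsymm
    · exact hpd i
    · exact hpd j
  rw [Bundle.contMDiffAt_totalSpace] at h
  exact h.2.contDiffAt

lemma matrix_symm (e : OpenPartialHomeomorph M E3) (x : E3) (i j : Fin 3) :
    g.matrix e x i j = g.matrix e x j i := g.symm _ _ _

/-- The differentials of `e` and `e.symm` are mutually inverse, so `v = ∑ dx^i(v) ∂_i`; bilinearity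
does the rest. -/
lemma form_eq {e : OpenPartialHomeomorph M E3} (he : e ∈ atlas E3 M) {x : E3} (hx : x ∈ e.target)
    (v w : TangentSpace 𝓘(ℝ, E3) (e.symm x)) :
    g.form (e.symm x) v w = ∑ i, ∑ j, g.matrix e x i j
      * (chartDeriv e (e.symm x) v i : ℂ)
      * (chartDeriv e (e.symm x) w j : ℂ) := by
  have hd : e.MDifferentiable 𝓘(ℝ, E3) 𝓘(ℝ, E3) := mdifferentiable_of_mem_atlas he
  have hv (v : TangentSpace 𝓘(ℝ, E3) (e.symm x)) :
      v = ∑ i, chartDeriv e (e.symm x) v i •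
        chartSymmDeriv e x (EuclideanSpace.single i (1 : ℝ)) := by
    have h1 : chartSymmDeriv e x (chartDeriv e (e.symm x) v) = v := by
      have h := congrArg (fun L => L v) (hd.symm_comp_deriv (e.map_target hx))
      rw [e.right_inv hx] at h
      exact h
    have h2 : chartDeriv e (e.symm x) v =
        ∑ i, chartDeriv e (e.symm x) v i • EuclideanSpace.single i (1 : ℝ) := by
      ext j
      fin_cases j <;> simp [Fin.sum_univ_three]
    conv_lhs => rw [← h1, h2, map_sum]
    simp only [map_smul]
  have hm (i j : Fin 3) : g.matrix e x i j = g.form (e.symm x)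
      (chartSymmDeriv e x (EuclideanSpace.single i (1 : ℝ)))
      (chartSymmDeriv e x (EuclideanSpace.single j (1 : ℝ))) := rfl
  conv_lhs => rw [hv v, hv w]
  simp only [map_sum, map_smul, sum_apply, smul_apply,
    Complex.real_smul, hm]
  refine (Finset.sum_congr rfl fun i _ => Finset.mul_sum _ _ _).trans (Finset.sum_comm.trans ?_)
  refine Finset.sum_congr rfl fun i _ => Finset.sum_congr rfl fun j _ => ?_
  ring

lemma inner_eq_bil {e : OpenPartialHomeomorph M E3} (he : e ∈ atlas E3 M) {x : E3}
    (hx : x ∈ e.target) (V W : CTangent (e.symm x)) :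
    g.inner V W = bil (g.matrix e x) (comp e V) (comp e W) := by
  unfold inner
  induction V using TensorProduct.induction_on with
  | zero => simp [comp_zero, bil]
  | add V V' hV hV' => simp only [map_add, LinearMap.add_apply, hV, hV', comp_add, bil_add_left]
  | tmul r v =>
    induction W using TensorProduct.induction_on with
    | zero => simp [comp_zero, bil]
    | add W W' hW hW' => simp only [map_add, hW, hW', comp_add, bil_add_right]
    | tmul s w =>
      rw [complexify_tmul, g.form_eq he hx, bil]
      simp only [comp_tmul, Finset.mul_sum]
      exact Finset.sum_congr rfl fun _ _ => Finset.sum_congr rfl fun _ _ => by ring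

lemma phiAt_eq_bil {e : OpenPartialHomeomorph M E3} {x : E3}
    (hx : x ∈ e.target) (V W : CTangent (e.symm x)) :
    g.phiAt e V W = bil (phiMatrix (g.matrix e) x) (comp e V) (comp e W) := by
  rw [phiAt, e.right_inv hx]
  rfl

/-- The components of a null frame form a null frame. -/
lemma NullFrame.isNullFrame {g : ComplexMetric M} {e : OpenPartialHomeomorph M E3}
    (he : e ∈ atlas E3 M) {x : E3} (hx : x ∈ e.target) (F : g.NullFrame (e.symm x)) :
    IsNullFrame (g.matrix e x) (comp e F.k) (comp e F.l) (comp e F.n) where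
  symm := g.matrix_symm e x
  kk := by rw [← g.inner_eq_bil he hx, F.kk]
  ll := by rw [← g.inner_eq_bil he hx, F.ll]
  kl := by rw [← g.inner_eq_bil he hx, F.kl]
  kn := by rw [← g.inner_eq_bil he hx, F.kn]
  ln := by rw [← g.inner_eq_bil he hx, F.ln]
  nn := by rw [← g.inner_eq_bil he hx, F.nn]

/-- The frame itself certifies that the coordinate matrix is invertible, its Gram matrix being so.
-/
lemma NullFrame.isMetricAt {g : ComplexMetric M} {e : OpenPartialHomeomorph M E3}
    (he : e ∈ atlas E3 M) {x : E3} (hx : x ∈ e.target) (F : g.NullFrame (e.symm x)) :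
    IsMetricAt (g.matrix e) x where
  symm := g.matrix_symm e
  smooth := g.contDiffAt_matrix he hx
  det_ne := (F.isNullFrame he hx).det_ne_zero

lemma NullFrame.quartic_eq {g : ComplexMetric M} {e : OpenPartialHomeomorph M E3}
    {x : E3} (hx : x ∈ e.target) (F : g.NullFrame (e.symm x)) (s t : ℂ) :
    F.quartic e s t = (1 / 2) * bil (phiMatrix (g.matrix e) x)
      (nullVec (comp e F.k) (comp e F.l) (comp e F.n) s t)
      (nullVec (comp e F.k) (comp e F.l) (comp e F.n) s t) := by
  rw [quartic, g.phiAt_eq_bil hx, xi, comp_add, comp_add, comp_smul, comp_smul, comp_smul, nullVec]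

lemma dS_eq {e : OpenPartialHomeomorph M E3} {x : E3}
    (hx : x ∈ e.target) (V : CTangent (e.symm x)) :
    g.dS e V = ∑ a, comp e V a * pd a (scalarS (g.matrix e)) x := by
  rw [dS, e.right_inv hx]

lemma cottonAt_eq {e : OpenPartialHomeomorph M E3} {x : E3}
    (hx : x ∈ e.target) (U V W : CTangent (e.symm x)) :
    g.cottonAt e U V W =
      ∑ a, ∑ b, ∑ c, cotton (g.matrix e) a b c x * comp e U a * comp e V b * comp e W c := by
  rw [cottonAt, e.right_inv hx]

lemma innerCovDeriv_eq {e : OpenPartialHomeomorph M E3} {x : E3} (hx : x ∈ e.target)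
    (X Y Z : ∀ p : M, CTangent p) :
    g.innerCovDeriv e X Y Z (e.symm x) =
      bil (g.matrix e x) (covDerivAlong (g.matrix e) (comp e (X (e.symm x)))
        (fun y => comp e (Y (e.symm y))) x) (comp e (Z (e.symm x))) := by
  rw [innerCovDeriv, e.right_inv hx]
  simp only [bil, covDerivAlong, Fin.sum_univ_three]
  ring

end ComplexMetric

/-! ### The null structure on the manifold. -/

/-- The components of the tracefree Ricci tensor of Petrov type III in a frame adapted to a multiple
principal null structure. -/
lemma NullStructure.exists_adapted_frame {g : ComplexMetric M} {N : NullStructure g}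
    (hN : N.IsMultiplePrincipal) (hIII : g.IsPetrovIII) {e : OpenPartialHomeomorph M E3}
    (he : e ∈ atlas E3 M) {x : E3} (hx : x ∈ e.target) :
    IsMetricAt (g.matrix e) x ∧ ∃ F : g.NullFrame (e.symm x), F.k ∈ N.line (e.symm x) ∧
      (∀ V, bil (phiMatrix (g.matrix e) x) V (comp e F.k) = 0) ∧
      bil (phiMatrix (g.matrix e) x) (comp e F.n) (comp e F.n) = 0 ∧
      bil (phiMatrix (g.matrix e) x) (comp e F.l) (comp e F.n) ≠ 0 := by
  obtain ⟨F, hFk, c₀, c₁, c₂, hF⟩ := hN e he _ (e.map_target hx)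
  obtain ⟨F₁, α, β, hαβ, hF₁⟩ := hIII e he _ (e.map_target hx)
  have hG := F.isMetricAt he hx
  refine ⟨hG, F, hFk, adapted_components (F₁.isNullFrame he hx) (F.isNullFrame he hx)
    hG.phi_symm hG.phi_trace hαβ (fun s t => ?_) (c₀ := c₀) (c₁ := c₁) (c₂ := c₂) fun s t => ?_⟩
  · rw [← hF₁, F₁.quartic_eq hx]
  · rw [← hF, F.quartic_eq hx]

/-- A multiple principal null structure with `Φ` of Petrov type III is co-geodetic as soon as
`k^a (A_{abc} - 2 g_{a[b} ∇_{c]} S) = 0`. -/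
theorem NullStructure.isCoGeodetic_of_petrovIII (g : ComplexMetric M) (N : NullStructure g)
    (hN : N.IsMultiplePrincipal) (hIII : g.IsPetrovIII)
    (hA : ∀ e ∈ atlas E3 M, ∀ p ∈ e.source, ∀ k ∈ N.line p, ∀ v w : CTangent p,
      g.cottonAt e k v w - (g.inner k v * g.dS e w - g.inner k w * g.dS e v) = 0) :
    N.IsCoGeodetic := by
  intro U hU X Y Z hX hY hZ hXp hYp hZp e he p ⟨hpU, hpe⟩
  obtain ⟨x, hx, rfl⟩ : ∃ x ∈ e.target, e.symm x = p := ⟨e p, e.map_source hpe, e.left_inv hpe⟩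
  obtain ⟨hG, F, hFk, hΦk, hΦnn, hΦln⟩ := NullStructure.exists_adapted_frame hN hIII he hx
  have hF := F.isNullFrame he hx
  obtain ⟨U', hU', hpU', k, hk, hline⟩ := N.smooth (e.symm x)
  have hkU (q : M) (hq : q ∈ U') : k q ∈ N.line q := by
    rw [hline q hq]
    exact Submodule.mem_span_singleton_self _
  have hnear : ∀ᶠ y in nhds x, y ∈ e.target ∧ e.symm y ∈ U ∧ e.symm y ∈ U' :=
    (e.open_target.mem_nhds hx |> Filter.Eventually.and <|
      ((e.continuousAt_symm hx).eventually (hU.mem_nhds hpU)).and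
        ((e.continuousAt_symm hx).eventually (hU'.mem_nhds hpU')))
  set G := g.matrix e
  set K : E3 → Fin 3 → ℂ := fun y => comp e (k (e.symm y)) with hK
  set Y' : E3 → Fin 3 → ℂ := fun y => comp e (Y (e.symm y)) with hY'
  have hKd (i : Fin 3) : DifferentiableAt ℝ (fun y => K y i) x :=
    (contDiffAt_comp he hU' hk hx hpU' i).differentiableAt (by simp)
  have hYd (i : Fin 3) : DifferentiableAt ℝ (fun y => Y' y i) x :=
    (contDiffAt_comp he hU hY hx hpU i).differentiableAt (by simp)
  have hKK : ∀ᶠ y in nhds x, bil (G y) (K y) (K y) = 0 := hnear.mono fun y hy => by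
    rw [← g.inner_eq_bil he hy.1]
    exact N.null _ _ (hkU _ hy.2.2)
  have hYK : ∀ᶠ y in nhds x, bil (G y) (Y' y) (K y) = 0 := hnear.mono fun y hy => by
    rw [← g.inner_eq_bil he hy.1]
    exact hYp _ hy.2.1 _ (hkU _ hy.2.2)
  -- The adapted frames are chosen point by point, with no smoothness in `y`. What passes to the
  -- smooth generator `K` is `Φ(·, k) = 0`, which is unaffected by rescaling `k`; it is needed on a
  -- neighbourhood because it is going to be differentiated.
  have hΦK : ∀ᶠ y in nhds x, ∀ c, ∑ a, phi G c a y * K y a = 0 := hnear.mono fun y hy c => by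
    obtain ⟨-, F', hF'k, hΦ', -⟩ := NullStructure.exists_adapted_frame hN hIII he hy.1
    have hF'0 : F'.k ≠ 0 := fun h0 => by simpa [h0, ComplexMetric.inner] using F'.kl
    obtain ⟨r, hr⟩ : ∃ r : ℂ, r • F'.k = k (e.symm y) :=
      (finrank_eq_one_iff_of_nonzero' (⟨F'.k, hF'k⟩ : N.line (e.symm y))
        (by simpa using hF'0)).mp (N.finrank_line _) ⟨k (e.symm y), hkU _ hy.2.2⟩ |>.imp
        fun r hr => congrArg Subtype.val hr
    have hK' : K y = r • comp e F'.k := by rw [← comp_smul, hr]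
    have h0 : bil (phiMatrix G y) (Pi.single c 1) (K y) = 0 := by
      rw [hK', bil_smul_right, hΦ', mul_zero]
    simpa [bil, phiMatrix, Pi.single_apply] using h0
  set w : (Fin 3 → ℂ) → Fin 3 → ℂ := fun V => covDerivAlong G V K x with hw
  -- Differentiating `g(k, k) = 0` shows that `g(∇_V k, k)` is its own negative.
  have hwK (V : Fin 3 → ℂ) : bil (G x) (w V) (K x) = 0 := by
    have h := hG.bil_covDerivAlong hKd hKd hKK V
    rw [bil_comm (K x) _ (hG.symm x)] at h
    exact self_eq_neg.mp h
  have hwF (V : Fin 3 → ℂ) : bil (G x) (w V) (comp e F.k) = 0 := by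
    rw [hline _ hpU'] at hFk
    obtain ⟨r, hr⟩ := Submodule.mem_span_singleton.mp hFk
    rw [← hr, comp_smul, bil_smul_right, hwK, mul_zero]
  have hsymm : bil (phiMatrix G x) (comp e F.l) (w (comp e (X (e.symm x)))) =
      bil (phiMatrix G x) (comp e (X (e.symm x))) (w (comp e F.l)) := by
    have h := hA e he _ hpe _ (hkU _ hpU') (X (e.symm x)) F.l
    rw [g.cottonAt_eq hx, g.dS_eq hx, g.dS_eq hx, g.inner_eq_bil he hx, g.inner_eq_bil he hx,
      hG.sum_cotton hKd hΦK] at h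
    linear_combination h
  have hXY := bil_eq_zero_of_symm hF hΦk hG.phi_symm hΦnn hΦln hwF hsymm
    (X := comp e (X (e.symm x))) (Y := Y' x)
    (by rw [← g.inner_eq_bil he hx]; exact hXp _ hpU _ hFk)
    (by rw [← g.inner_eq_bil he hx]; exact hYp _ hpU _ hFk)
  have hZ' := hZp _ hpU
  rw [hline _ hpU'] at hZ'
  obtain ⟨r, hr⟩ := Submodule.mem_span_singleton.mp hZ'
  -- `Z` enters only through its value at the point, a multiple of `k`; the derivative of `Y` is
  -- then moved onto `k`.
  rw [g.innerCovDeriv_eq hx, ← hr, comp_smul, bil_smul_right,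
    hG.bil_covDerivAlong hYd hKd hYK, hXY]
  simp

end

end ThreeGeometry

theorem mainTheorem6 {M : Type*} [TopologicalSpace M] [ChartedSpace ThreeGeometry.E3 M]
    [IsManifold 𝓘(ℝ, ThreeGeometry.E3) ∞ M]
    (g : ThreeGeometry.ComplexMetric M) (N : ThreeGeometry.NullStructure g)
    (hN : N.IsMultiplePrincipal) (hIII : g.IsPetrovIII)
    -- `k^a (A_{abc} - 2 g_{a[b} ∇_{c]} S) = 0`
    (h1 : ∀ e ∈ atlas ThreeGeometry.E3 M, ∀ p ∈ e.source, ∀ k ∈ N.line p,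
      ∀ v w : ThreeGeometry.CTangent p,
        g.cottonAt e k v w - (g.inner k v * g.dS e w - g.inner k w * g.dS e v) = 0)
    -- `k^a k^b A_{abc} = 0`
    (h2 : ∀ e ∈ atlas ThreeGeometry.E3 M, ∀ p ∈ e.source, ∀ k ∈ N.line p,
      ∀ w : ThreeGeometry.CTangent p, g.cottonAt e k k w = 0)
    -- `k^a ∇_a S = 0`
    (h3 : ∀ e ∈ atlas ThreeGeometry.E3 M, ∀ p ∈ e.source, ∀ k ∈ N.line p, g.dS e k = 0) :
    N.IsCoGeodetic :=
  ThreeGeometry.NullStructure.isCoGeodetic_of_petrovIII g N hN hIII h1
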